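/- Let $G=(V\sqcup W,E)$ be a finite bipartite graph with colour classes $V$ and $W$ (possibly disconnected). Let $\mathbf v,\mathbf w$ denote the standard basis vectors of $\mathbb R^V\oplus\mathbb R^W$. The root polytope of $G$ is $$Q_G=\operatorname{Conv}\{\mathbf v+\mathbf w \mid v\in V,\ w\in W,\ vw\in E\},$$ its Ehrhart series is the formal power series $$\operatorname{Ehr}_{Q_G}(x)=1+\sum_{s\ge 1}\bigl|(s\cdot Q_G)\cap(\mathbb Z^V\oplus\mathbb Z^W)\bigr|\,x^s,$$ and, if $V\sqcup W$ is non-empty, the interior polynomial of $G$ is $$I_G(x)=(1-x)^{|V|+|W|-1}\operatorname{Ehr}_{Q_G}(x).$$ For $J\subseteq V$, let $G-J$ be the bipartite graph, with colour classes $V\setminus J$ and $W$, obtained from $G$ by deleting all vertices in $J$ and all edges incident to them. For $S\subseteq V$, let $N_G(S)$ be the set of vertices $w\in W$ that are adjacent to some vertex of $S$. Theorem. Let $S\subseteq V$ be a non-empty set such that every vertex of $S$ has at least one neighbour in $G$, and suppose that $S$ is non-expanding, i.e. $|S|\ge|N_G(S)|$. Then $$\sum_{J\subseteq S}(-1)^{|J|}I_{G-J}(x)=0,$$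 as an identity of formal power series in $\mathbb Z[[x]]$ (equivalently, of polynomials). -/

import Mathlib

open scoped Pointwise

/-- The root polytope of a (bipartite) graph `G` on the vertex set `U`: the convex hull in `ℝ^U`
of the vectors `e_v + e_w`, where `vw` runs over the edges of `G`. For a bipartite graph with
colour classes `V`, `W` partitioning `U`, the space `ℝ^U` is `ℝ^V ⊕ ℝ^W`. -/
def rootPolytope {U : Type*} [DecidableEq U] (G : SimpleGraph U) : Set (U → ℝ) :=
  convexHull ℝ {x | ∃ v w : U, G.Adj v w ∧ x = Pi.single v 1 + Pi.single w 1}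

/-- The number of points of the integer lattice `ℤ^U` in the dilate `s · Q` of `Q ⊆ ℝ^U`. -/
noncomputable def latticeCount {U : Type*} (Q : Set (U → ℝ)) (s : ℕ) : ℕ :=
  {z : U → ℤ | (fun u => (z u : ℝ)) ∈ (s : ℝ) • Q}.ncard

/-- The Ehrhart series `1 + ∑_{s ≥ 1} |s · Q ∩ ℤ^U| x^s`, a formal power series. -/
noncomputable def ehrhartSeries {U : Type*} (Q : Set (U → ℝ)) : PowerSeries ℤ :=
  PowerSeries.mk fun s => if s = 0 then 1 else (latticeCount Q s : ℤ)

/-- The interior polynomial `(1 - x)^(|U| - 1) · Ehr_{Q_G}(x)` of a bipartite graph `G` with a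
non-empty finite vertex set `U`, regarded as an element of `ℤ⟦x⟧`. -/
noncomputable def interiorPolynomial {U : Type*} [DecidableEq U] (G : SimpleGraph U) :
    PowerSeries ℤ :=
  (1 - PowerSeries.X) ^ (Nat.card U - 1) * ehrhartSeries (rootPolytope G)

/-- `N_G(S)`: the set of all vertices adjacent to some vertex of `S`. -/
def neighborsOf {U : Type*} (G : SimpleGraph U) (S : Finset U) : Set U :=
  ⋃ v ∈ S, G.neighborSet v

/-- `S` is non-expanding if `|S| ≥ |N_G(S)|`. -/
def IsNonExpanding {U : Type*} (G : SimpleGraph U) (S : Finset U) : Prop :=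
  (neighborsOf G S).ncard ≤ S.card

/-- `G - J`: the graph obtained from `G` by deleting the vertices in `J` and all incident edges;
its vertex set is the complement of `J`. -/
abbrev deleteVertices {U : Type*} (G : SimpleGraph U) (J : Finset U) :
    SimpleGraph {u : U // u ∉ J} :=
  G.comap Subtype.val

/-!
The lattice points of `s · Q_{G-J}` are the vectors `a + b` with `a ∈ ℕ^(V \ J)`, `b ∈ ℕ^W`, both
of coordinate sum `s`, such that units of supply `a` can be matched along edges to units of demand
`b`. By Hall's theorem (`exists_matching_of_mem_demands`) this means `b(X) ≤ a(N(X))` for all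
`X ⊆ W`; write `B(a)` (`demands`) for the set of such `b`. Inclusion-exclusion over the vertices
where `a` vanishes, together with the binomial theorem, turns the alternating sum of interior
polynomials into a multiple of `∑_T (-x)^(|S| - |T|) E_T(x)`, where `T` runs over the subsets of
`S` and `E_T` counts the pairs `(a, b)` with `a` positive on `T`. Writing `a = c + 1_T`, the claim
becomes `∑_{T ⊆ S} (-1)^|T| #B(c + 1_T) = 0` for every `c ∈ ℕ^V`
(`alternating_card_demands_eq_zero`).

To prove this, `S` may be replaced by a minimal non-expanding subset, for which
`|A| ≤ |S ∩ N(A)|` whenever `A ⊆ N(S)`. The slack `X ↦ a(N(X)) - b(X)` is submodular, so the poset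
of the sets `X` where it is negative is empty or conically contractible; its Euler characteristic
therefore detects Hall's condition (`chainEuler_violators`). Ordering chains by their least element
`X` expresses the indicator function of `B(c + 1_T)` as `1` minus a sum over `X` of terms which
depend only on slacks at supersets of `X`. Such a term does not change if a vertex
`v ∈ S ∩ N(X)` joins `T` while some coordinate `b w` with `w ∈ X ∩ N(S)` grows by one. As there are
at least as many such `v` as there are such `w`, a sign-reversing pairing cancels everything
(`alternating_sum_eq_zero`).
-/

open Finset

/-! ### The Euler characteristic of a finite poset -/

open scoped Classical in
/-- `1 - χ(M)`, where `χ(M)` is the Euler characteristic of the order complex of the finite poset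
`M`: the sum of `(-1) ^ #C` over all chains `C ⊆ M`, organised by the least element of `C`. -/
noncomputable def chainEuler {α : Type*} [PartialOrder α] (M : Finset α) : ℤ :=
  1 - ∑ X ∈ M.attach, chainEuler (M.filter fun Y => X.1 < Y)
termination_by #M
decreasing_by
  exact card_lt_card ((filter_ssubset).2 ⟨X.1, X.2, lt_irrefl _⟩)

theorem chainEuler_eq {α : Type*} [PartialOrder α] [DecidableLT α] (M : Finset α) :
    chainEuler M = 1 - ∑ X ∈ M, chainEuler (M.filter fun Y => X < Y) := by
  rw [chainEuler, ← sum_attach M]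
  congr!

@[simp] theorem chainEuler_empty {α : Type*} [PartialOrder α] :
    chainEuler (∅ : Finset α) = 1 := by
  classical
  rw [chainEuler_eq]; simp

/-- A poset with an element `P` such that `Y ↦ Y ⊔ P` maps it to itself is conically contractible,
`Y ≤ Y ⊔ P ≥ P`, so its Euler characteristic is `1`. -/
theorem chainEuler_eq_zero_of_sup_mem {α : Type*} [SemilatticeSup α] {M : Finset α} {P : α}
    (hP : P ∈ M) (hsup : ∀ Y ∈ M, Y ⊔ P ∈ M) : chainEuler M = 0 := by
  classical
  induction hn : #M using Nat.strong_induction_on generalizing M P with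
  | _ n ih =>
    subst hn
    have key : ∀ X ∈ M, ¬ P ≤ X → chainEuler (M.filter fun Y => X < Y) = 0 := by
      intro X hX hPX
      refine ih _ (card_lt_card (filter_ssubset.2 ⟨X, hX, lt_irrefl _⟩)) (P := X ⊔ P) ?_ ?_ rfl
      · exact mem_filter.2 ⟨hsup X hX, left_lt_sup.2 hPX⟩
      · intro Y hY
        rw [mem_filter] at hY ⊢
        have : Y ⊔ (X ⊔ P) = Y ⊔ P := by
          rw [← sup_assoc, sup_eq_left.2 hY.2.le]
        rw [this]
        exact ⟨hsup Y hY.1, hY.2.trans_le le_sup_left⟩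
    have h1 : ∑ X ∈ M, chainEuler (M.filter fun Y => X < Y)
        = ∑ X ∈ insert P (M.filter fun Y => P < Y), chainEuler (M.filter fun Y => X < Y) := by
      symm
      apply sum_subset
      · intro X hX
        rcases mem_insert.1 hX with rfl | hX
        · exact hP
        · exact (mem_filter.1 hX).1
      · intro X hX hX'
        refine key X hX fun hle => hX' ?_
        rcases hle.eq_or_lt with rfl | hlt
        · exact mem_insert_self _ _
        · exact mem_insert_of_mem (mem_filter.2 ⟨hX, hlt⟩)
    have h2 : ∀ X ∈ M.filter (fun Y => P < Y), (M.filter fun Y => X < Y)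
        = (M.filter fun Y => P < Y).filter fun Y => X < Y := by
      intro X hX
      rw [filter_filter]
      refine filter_congr fun Y _ => ?_
      exact ⟨fun h => ⟨(mem_filter.1 hX).2.trans h, h⟩, fun h => h.2⟩
    rw [chainEuler_eq, h1, sum_insert (by simp), chainEuler_eq (M.filter fun Y => P < Y)]
    rw [sum_congr rfl fun X hX => congrArg chainEuler (h2 X hX)]
    ring

/-! ### A sign-reversing cancellation -/

/-- The vectors with sum `n + 1` and `b w ≠ 0` are those of the form `b + e_w`. -/
theorem sum_piAntidiag_succ {β : Type*} [DecidableEq β] {W : Finset β} {w : β} (hw : w ∈ W)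
    (n : ℕ) (F : (β → ℕ) → ℤ) :
    ∑ b ∈ piAntidiag W (n + 1), F b = ∑ b ∈ piAntidiag W n, F (b + Pi.single w 1) +
      ∑ b ∈ piAntidiag W (n + 1), if b w = 0 then F b else 0 := by
  rw [← sum_filter_add_sum_filter_not (piAntidiag W (n + 1)) (fun b => b w = 0), add_comm,
    sum_filter (fun b : β → ℕ => b w = 0)]
  congr 1
  symm
  refine sum_nbij' (fun b => b + Pi.single w 1) (fun b => b - Pi.single w 1) ?_ ?_ ?_ ?_ ?_
  · intro b hb
    rw [mem_piAntidiag] at hb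
    simp only [mem_filter, mem_piAntidiag, Pi.add_apply, Pi.single_eq_same, sum_add_distrib, hb.1]
    refine ⟨⟨by simp [hw], fun i hi => ?_⟩, by simp⟩
    by_cases h : i = w
    · exact h ▸ hw
    · exact hb.2 i (by simpa [h] using hi)
  · intro b hb
    simp only [mem_filter, mem_piAntidiag] at hb ⊢
    obtain ⟨⟨hb1, hb2⟩, hb3⟩ := hb
    refine ⟨?_, fun i hi => hb2 i fun h0 => hi (by simp [h0])⟩
    have h1 : b = (b - Pi.single w 1) + Pi.single w 1 := by
      ext i
      by_cases h : i = w
      · subst h; simp; lia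
      · simp [h]
    rw [h1] at hb1
    simp only [Pi.add_apply, sum_add_distrib] at hb1
    have : ∑ x ∈ W, (Pi.single w 1 : β → ℕ) x = 1 := by simp [hw]
    lia
  · intro b _
    simp
  · intro b hb
    simp only [mem_filter] at hb
    ext i
    by_cases h : i = w
    · subst h; simp; lia
    · simp [h]
  · intro b _; rfl

/-- Let `F T b` depend on a set `T ⊆ S` and a vector `b ∈ ℕ^W` with sum `n + #T`, and suppose that
it is unchanged when some `v ∈ R` is added to `T` and, at the same time, some coordinate
`b w`, `w ∈ A`, is raised by one. If `#A ≤ #R` and `F T b` is supported where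
`∑ w ∈ A, b w` is at least `#(T ∩ R) + δ`, then the alternating sum of `F` vanishes.
Pairing `(T, b)` with `(insert v T, b + e_w)` leaves only the terms with `v ∈ T` and `b w = 0`,
an instance of the same situation with `v` and `w` removed and `δ` raised by one; when `A` is
exhausted, the support is empty. -/
theorem alternating_sum_eq_zero {α β : Type*} [DecidableEq α] [DecidableEq β]
    {W A : Finset β} {S R : Finset α} {n δ : ℕ} {F : Finset α → (β → ℕ) → ℤ}
    (hAW : A ⊆ W) (hRS : R ⊆ S) (hAR : #A ≤ #R) (hA : A.Nonempty ∨ 1 ≤ δ)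
    (hinv : ∀ v ∈ R, ∀ w ∈ A, ∀ T b, v ∉ T → F (insert v T) (b + Pi.single w 1) = F T b)
    (hsupp : ∀ T ⊆ S, ∀ b ∈ piAntidiag W (n + #T), F T b ≠ 0 → #(T ∩ R) + δ ≤ ∑ w ∈ A, b w) :
    ∑ T ∈ S.powerset, (-1) ^ #T * ∑ b ∈ piAntidiag W (n + #T), F T b = 0 := by
  induction A using Finset.induction_on generalizing S R n δ F with
  | empty =>
    refine sum_eq_zero fun T hT => ?_
    rw [sum_eq_zero, mul_zero]
    intro b hb
    by_contra hF
    have := hsupp T (mem_powerset.1 hT) b hb hF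
    simp at this hA
    lia
  | insert w A hwA ih =>
    have hw : w ∈ W := hAW (mem_insert_self _ _)
    rw [card_insert_of_notMem hwA] at hAR
    obtain ⟨v, hv⟩ : R.Nonempty := card_pos.1 (by lia)
    have hvS := hRS hv
    have main := ih (S := S.erase v) (R := R.erase v) (n := n + 1) (δ := δ + 1)
      (F := fun T b => if b w = 0 then F (insert v T) b else 0)
      ((subset_insert _ _).trans hAW) (erase_subset_erase _ hRS)
      (by rw [card_erase_of_mem hv]; lia) (Or.inr (by lia))
      (by
        intro v' hv' w' hw' T b hT
        have hne : w ≠ w' := fun h => hwA (h ▸ hw')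
        have : (b + Pi.single w' 1 : β → ℕ) w = b w := by simp [hne]
        simp only [this]
        rw [insert_comm, hinv v' (mem_of_mem_erase hv') w' (mem_insert_of_mem hw')]
        simp [ne_of_mem_erase hv', hT])
      (by
        intro T hT b hb hF
        have hvT : v ∉ T := fun h => notMem_erase v S (hT h)
        have h0 : b w = 0 := by by_contra h; simp [h] at hF
        simp only [h0, if_true] at hF
        have := hsupp (insert v T) (insert_subset hvS (hT.trans (erase_subset _ _))) b
          (by rw [card_insert_of_notMem hvT, add_comm #T, ← add_assoc]; exact hb) hF
        rw [sum_insert hwA, h0, zero_add, insert_inter_of_mem hv,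
          card_insert_of_notMem (by simp [hvT])] at this
        have h3 : T ∩ R.erase v = T ∩ R := by
          ext x; simp only [mem_inter, mem_erase]
          exact ⟨fun h => ⟨h.1, h.2.2⟩, fun h => ⟨h.1, fun e => hvT (e ▸ h.1), h.2⟩⟩
        rw [h3]; lia)
    rw [← insert_erase hvS, sum_powerset_insert (notMem_erase v S), ← sum_add_distrib]
    rw [← neg_eq_zero, ← sum_neg_distrib, ← main]
    refine sum_congr rfl fun T hT => ?_
    have hvT : v ∉ T := fun h => notMem_erase v S (mem_powerset.1 hT h)
    rw [card_insert_of_notMem hvT, ← add_assoc, sum_piAntidiag_succ hw,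
      sum_congr rfl fun b _ => hinv v hv w (mem_insert_self _ _) T b hvT,
      add_right_comm n 1 #T]
    ring

/-! ### Demand vectors of a bipartite relation -/

section Demands

variable {α β : Type*} (r : α → β → Prop) (V : Finset α)
  (W : Finset β)

open scoped Classical in
/-- The vertices of `V` adjacent, under `r`, to some vertex of `X`. -/
noncomputable def nbrs (X : Finset β) : Finset α := V.filter fun v => ∃ w ∈ X, r v w

open scoped Classical in
/-- The vectors `b ∈ ℕ^W` that can be written as `∑ v ∈ V, b_v`, where `b_v ∈ ℕ^W` has sum `a v`
and is supported on the neighbours of `v`; they are encoded by Hall's condition. -/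
noncomputable def demands [DecidableEq β] (a : α → ℕ) : Finset (β → ℕ) :=
  (piAntidiag W (∑ v ∈ V, a v)).filter fun b => ∀ X ⊆ W, ∑ w ∈ X, b w ≤ ∑ v ∈ nbrs r V X, a v

/-- The subsets of `W` at which Hall's condition for the supply `a` and the demand `b` fails. -/
noncomputable def violators (a : α → ℕ) (b : β → ℕ) : Finset (Finset β) :=
  W.powerset.filter fun X => ∑ v ∈ nbrs r V X, a v < ∑ w ∈ X, b w

variable {r V W}

theorem mem_nbrs {X : Finset β} {v : α} : v ∈ nbrs r V X ↔ v ∈ V ∧ ∃ w ∈ X, r v w := by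
  simp [nbrs]

theorem nbrs_subset (X : Finset β) : nbrs r V X ⊆ V := fun _ hv => (mem_nbrs.1 hv).1

theorem nbrs_mono {X Y : Finset β} (h : X ⊆ Y) : nbrs r V X ⊆ nbrs r V Y := fun v hv => by
  rw [mem_nbrs] at hv ⊢
  exact ⟨hv.1, hv.2.imp fun w hw => ⟨h hw.1, hw.2⟩⟩

theorem nbrs_union [DecidableEq α] [DecidableEq β] (X Y : Finset β) : nbrs r V (X ∪ Y) = nbrs r V X ∪ nbrs r V Y := by
  ext v
  simp only [mem_nbrs, mem_union]
  grind

theorem mem_demands [DecidableEq β] {a : α → ℕ} {b : β → ℕ} : b ∈ demands r V W a ↔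
    b ∈ piAntidiag W (∑ v ∈ V, a v) ∧ ∀ X ⊆ W, ∑ w ∈ X, b w ≤ ∑ v ∈ nbrs r V X, a v := by
  simp [demands]

theorem mem_violators {a : α → ℕ} {b : β → ℕ} {X : Finset β} : X ∈ violators r V W a b ↔
    X ⊆ W ∧ ∑ v ∈ nbrs r V X, a v < ∑ w ∈ X, b w := by
  simp [violators]

/-- The function `X ↦ a (nbrs X) - b X` is submodular; joining with a minimiser of it therefore
maps the set of violators to itself. -/
theorem chainEuler_violators [DecidableEq β] (a : α → ℕ) (b : β → ℕ) :
    chainEuler (violators r V W a b) = if violators r V W a b = ∅ then 1 else 0 := by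
  split_ifs with h
  · rw [h, chainEuler_empty]
  classical
  obtain ⟨P, hP, hmin⟩ := exists_min_image (violators r V W a b)
    (fun X => (∑ v ∈ nbrs r V X, a v : ℤ) - ∑ w ∈ X, (b w : ℤ)) (nonempty_iff_ne_empty.2 h)
  refine chainEuler_eq_zero_of_sup_mem hP fun Y hY => ?_
  have hP' := mem_violators.1 hP
  have hY' := mem_violators.1 hY
  rw [mem_violators, sup_eq_union]
  refine ⟨union_subset hY'.1 hP'.1, ?_⟩
  have e1 := sum_union_inter (s₁ := Y) (s₂ := P) (f := b)
  have e2 := sum_union_inter (s₁ := nbrs r V Y) (s₂ := nbrs r V P) (f := a)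
  have e3 : ∑ v ∈ nbrs r V (Y ∩ P), a v ≤ ∑ v ∈ nbrs r V Y ∩ nbrs r V P, a v :=
    sum_le_sum_of_subset
      (subset_inter (nbrs_mono inter_subset_left) (nbrs_mono inter_subset_right))
  rw [nbrs_union]
  by_cases hI : Y ∩ P ∈ violators r V W a b
  · have := hmin _ hI
    push_cast [← Nat.cast_sum] at this
    lia
  · have : ¬ _ := fun h => hI (mem_violators.2 ⟨inter_subset_left.trans hY'.1, h⟩)
    lia

open scoped Classical in
/-- The number of demand vectors, with Hall's condition for each vector `b` rewritten by
`chainEuler_violators` as an Euler characteristic. Any necessary condition `p` may be imposed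
on `b` beforehand. -/
theorem card_demands_eq_sum [DecidableEq β] (a : α → ℕ) (p : (β → ℕ) → Prop)
    (hp : ∀ b, (∀ X ⊆ W, ∑ w ∈ X, b w ≤ ∑ v ∈ nbrs r V X, a v) → p b) :
    (#(demands r V W a) : ℤ) = ∑ b ∈ piAntidiag W (∑ v ∈ V, a v),
      ((if p b then 1 else 0) - ∑ X ∈ W.powerset,
        if p b ∧ X ∈ violators r V W a b then
          chainEuler ((violators r V W a b).filter fun Y => X < Y) else 0) := by
  rw [demands, card_filter, Nat.cast_sum]
  refine sum_congr rfl fun b _ => ?_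
  have hv : violators r V W a b = ∅ ↔ ∀ X ⊆ W, ∑ w ∈ X, b w ≤ ∑ v ∈ nbrs r V X, a v := by
    simp [violators, filter_eq_empty_iff]
  by_cases hb : p b
  · have h := chainEuler_violators (r := r) (V := V) (W := W) a b
    rw [chainEuler_eq] at h
    simp only [hb, if_true, true_and]
    rw [← sum_filter]
    have : W.powerset.filter (fun X => X ∈ violators r V W a b) = violators r V W a b := by
      ext X
      simp only [mem_filter, mem_powerset, and_iff_right_iff_imp]
      exact fun h => (mem_violators.1 h).1
    rw [this, h]
    simp only [hv]
    split_ifs <;> rfl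
  · have : ¬ ∀ X ⊆ W, ∑ w ∈ X, b w ≤ ∑ v ∈ nbrs r V X, a v := fun h => hb (hp b h)
    simp [hb, this]

theorem sum_add_indicator [DecidableEq α] {c : α → ℕ} {T Z : Finset α} :
    ∑ v ∈ Z, (c v + if v ∈ T then 1 else 0) = ∑ v ∈ Z, c v + #(T ∩ Z) := by
  rw [sum_add_distrib, sum_ite_mem, inter_comm Z T]; simp

theorem sum_add_single_of_mem [DecidableEq β] {b : β → ℕ} {X : Finset β} {w : β} (hw : w ∈ X) :
    ∑ x ∈ X, (b + Pi.single w 1 : β → ℕ) x = ∑ x ∈ X, b x + 1 := by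
  simp [sum_add_distrib, hw]

open scoped Classical in
/-- Raising the supplies by the indicator vectors of the subsets `T` of
`S` gives numbers of demand vectors with vanishing alternating sum, provided that `S` satisfies
Hall's condition with respect to the set `N` of its neighbours (in the direction from `N`
to `S`).

Fix the coordinates of `b` outside `N`, where Hall's condition does not involve `T`.
By `chainEuler_violators`, the indicator function of Hall's condition is `1` minus a sum over the
violators `X` of weights that depend only on the slacks of Hall's condition at supersets of `X`.
Those slacks do not change when an element `v ∈ S` adjacent to `X` joins `T` and a coordinate
`b w` with `w ∈ X ∩ N` grows by one, so that `alternating_sum_eq_zero` applies to every `X`. -/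
theorem alternating_card_demands_eq_zero_of_hall [DecidableEq α] [DecidableEq β]
    {S : Finset α} (hSV : S ⊆ V)
    (hN : (W.filter fun w => ∃ v ∈ S, r v w).Nonempty)
    (hall : ∀ A ⊆ W.filter fun w => ∃ v ∈ S, r v w, #A ≤ #(S ∩ nbrs r V A)) (c : α → ℕ) :
    ∑ T ∈ S.powerset, (-1 : ℤ) ^ #T *
      (#(demands r V W fun v => c v + if v ∈ T then 1 else 0) : ℤ) = 0 := by
  set N := W.filter fun w => ∃ v ∈ S, r v w with hNdef
  obtain ⟨p, hp⟩ : ∃ p : (β → ℕ) → Prop, ∀ b, p b ↔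
      ∀ X ⊆ W \ N, ∑ w ∈ X, b w ≤ ∑ v ∈ nbrs r V X, c v := ⟨_, fun _ => Iff.rfl⟩
  -- Hall's condition at subsets of `W \ N` does not involve the elements of `S`.
  have hout : ∀ X ⊆ W \ N, ∀ v ∈ S, v ∉ nbrs r V X := by
    intro X hX v hv hvX
    obtain ⟨_, w, hw, hvw⟩ := mem_nbrs.1 hvX
    have := mem_sdiff.1 (hX hw)
    exact this.2 (mem_filter.2 ⟨this.1, v, hv, hvw⟩)
  have hpinv : ∀ w ∈ N, ∀ b, p (b + Pi.single w 1) ↔ p b := by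
    intro w hw b
    rw [hp, hp]
    refine forall₂_congr fun X hX => ?_
    have : ∑ x ∈ X, (b + Pi.single w 1 : β → ℕ) x = ∑ x ∈ X, b x := by
      have : w ∉ X := fun h => (mem_sdiff.1 (hX h)).2 hw
      simp [sum_add_distrib, this]
    rw [this]
  -- Raising the supply of `v` and the demand of `w` by one preserves the slack at all supersets
  -- of `X`.
  have hvinv : ∀ X, ∀ v ∈ S ∩ nbrs r V X, ∀ w ∈ X, ∀ T : Finset α, v ∉ T → ∀ b Y, X ⊆ Y →
      (Y ∈ violators r V W (fun u => c u + if u ∈ insert v T then 1 else 0) (b + Pi.single w 1) ↔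
        Y ∈ violators r V W (fun u => c u + if u ∈ T then 1 else 0) b) := by
    intro X v hv w hw T hvT b Y hXY
    rw [mem_violators, mem_violators, sum_add_indicator, sum_add_indicator,
      sum_add_single_of_mem (hXY hw),
      insert_inter_of_mem (nbrs_mono hXY (mem_inter.1 hv).2),
      card_insert_of_notMem (fun h => hvT (mem_inter.1 h).1), ← add_assoc, add_lt_add_iff_right]
  have hcard : ∀ T ∈ S.powerset, (-1 : ℤ) ^ #T *
      (#(demands r V W fun v => c v + if v ∈ T then 1 else 0) : ℤ)
      = (-1 : ℤ) ^ #T * ∑ b ∈ piAntidiag W (∑ v ∈ V, c v + #T), (if p b then 1 else 0)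
      - ∑ X ∈ W.powerset, (-1 : ℤ) ^ #T * ∑ b ∈ piAntidiag W (∑ v ∈ V, c v + #T),
        (if p b ∧ X ∈ violators r V W (fun v => c v + if v ∈ T then 1 else 0) b then
          chainEuler ((violators r V W (fun v => c v + if v ∈ T then 1 else 0) b).filter
            fun Y => X < Y) else 0) := by
    intro T hT
    have hTS := mem_powerset.1 hT
    rw [card_demands_eq_sum _ p, sum_add_indicator, inter_eq_left.2 (hTS.trans hSV),
      sum_sub_distrib, mul_sub, sum_comm (s := piAntidiag W _), mul_sum W.powerset]
    intro b hb
    rw [hp]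
    intro X hX
    refine (hb X (hX.trans sdiff_subset)).trans_eq ?_
    rw [sum_add_indicator]
    have : T ∩ nbrs r V X = ∅ := by
      ext v
      simp only [mem_inter, notMem_empty, iff_false, not_and]
      exact fun hv => hout X hX v (hTS hv)
    simp [this]
  rw [sum_congr rfl hcard, sum_sub_distrib, sum_comm (s := S.powerset)]
  have hsplit : ∀ (X : Finset β) (b : β → ℕ), ∑ w ∈ X, b w = ∑ w ∈ X ∩ N, b w + ∑ w ∈ X \ N, b w := by
    intro X b
    exact (sum_inter_add_sum_sdiff X N b).symm
  rw [sum_eq_zero (s := W.powerset), sub_zero]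
  -- The constant term `1`: here `∑ w ∈ N, b w ≥ #T` follows from the prescribed sum of `b` and
  -- Hall's condition at `W \ N`.
  · refine alternating_sum_eq_zero (A := N) (R := S) (δ := 0) (filter_subset _ _) subset_rfl
      ((hall N subset_rfl).trans (card_le_card inter_subset_left)) (Or.inl hN) ?_ ?_
    · intro v _ w hw T b _
      simp only [hpinv w hw]
    · intro T hT b hb hF
      have hpb : p b := by by_contra h; simp [h] at hF
      have h1 := (hp b).1 hpb (W \ N) subset_rfl
      have h2 : ∑ v ∈ nbrs r V (W \ N), c v ≤ ∑ v ∈ V, c v :=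
        sum_le_sum_of_subset (nbrs_subset _)
      have h3 := hsplit W b
      rw [inter_eq_right.2 (filter_subset _ _ : N ⊆ W)] at h3
      have h4 := (mem_piAntidiag.1 hb).1
      rw [inter_eq_left.2 hT]
      change ∑ w ∈ W, b w = _ at h4
      lia
  -- The term of a violator `X`: the violation is strict, which gives `δ = 1` and so covers the
  -- case that `X ∩ N` is empty.
  · intro X hX
    have hXW := mem_powerset.1 hX
    have hXN : S ∩ nbrs r V (X ∩ N) ⊆ S ∩ nbrs r V X :=
      inter_subset_inter subset_rfl (nbrs_mono inter_subset_left)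
    refine alternating_sum_eq_zero (A := X ∩ N) (R := S ∩ nbrs r V X) (δ := 1)
      (inter_subset_left.trans hXW) inter_subset_left
      ((hall _ inter_subset_right).trans (card_le_card hXN)) (Or.inr le_rfl) ?_ ?_
    · intro v hv w hw T b hvT
      have hw' := mem_inter.1 hw
      have h1 := hvinv X v hv w hw'.1 T hvT b
      have h2 : ∀ M M' : Finset (Finset β), (∀ Y, X ⊆ Y → (Y ∈ M ↔ Y ∈ M')) →
          M.filter (X < ·) = M'.filter (X < ·) := by
        intro M M' h
        ext Y
        simp only [mem_filter]
        exact and_congr_left fun hXY => h Y hXY.le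
      simp only [hpinv w hw'.2, h1 X subset_rfl, h2 _ _ h1]
    · intro T hT b hb hF
      have hF' : p b ∧ X ∈ violators r V W (fun v => c v + if v ∈ T then 1 else 0) b := by
        by_contra h; simp [h] at hF
      have h1 := (mem_violators.1 hF'.2).2
      rw [sum_add_indicator] at h1
      have h2 := (hp b).1 hF'.1 (X \ N) (sdiff_subset_sdiff hXW subset_rfl)
      have h3 : ∑ v ∈ nbrs r V (X \ N), c v ≤ ∑ v ∈ nbrs r V X, c v :=
        sum_le_sum_of_subset (nbrs_mono sdiff_subset)
      have h4 := hsplit X b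
      rw [← inter_assoc, inter_eq_left.2 hT]
      lia

open scoped Classical in
/-- A minimal non-expanding set `S₀ ⊆ S` satisfies the Hall condition of
`alternating_card_demands_eq_zero_of_hall`: for `A ⊆ N(S₀)`, the elements of `S₀` not adjacent
to `A` have at most `#N(S₀) - #A` neighbours, so there are at most that many of them. The elements
of `S \ S₀` only change the supply vector. -/
theorem alternating_card_demands_eq_zero [DecidableEq α] [DecidableEq β]
    {S : Finset α} (hSV : S ⊆ V) (hS : S.Nonempty)
    (hdeg : ∀ v ∈ S, ∃ w ∈ W, r v w) (hne : #(W.filter fun w => ∃ v ∈ S, r v w) ≤ #S)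
    (c : α → ℕ) :
    ∑ T ∈ S.powerset, (-1 : ℤ) ^ #T *
      (#(demands r V W fun v => c v + if v ∈ T then 1 else 0) : ℤ) = 0 := by
  obtain ⟨S₀, hS₀, hmin⟩ := exists_min_image
    (S.powerset.filter fun S' => S'.Nonempty ∧ #(W.filter fun w => ∃ v ∈ S', r v w) ≤ #S')
    (fun S' => #S') ⟨S, by simp [hS, hne]⟩
  simp only [mem_filter, mem_powerset] at hS₀ hmin
  obtain ⟨hS₀S, ⟨v₀, hv₀⟩, hne₀⟩ := hS₀
  have hN₀ : (W.filter fun w => ∃ v ∈ S₀, r v w).Nonempty := by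
    obtain ⟨w, hw, hvw⟩ := hdeg v₀ (hS₀S hv₀)
    exact ⟨w, mem_filter.2 ⟨hw, v₀, hv₀, hvw⟩⟩
  have hall : ∀ A ⊆ W.filter fun w => ∃ v ∈ S₀, r v w, #A ≤ #(S₀ ∩ nbrs r V A) := by
    intro A hA
    by_contra hlt
    have h1 := card_sdiff_add_card_inter S₀ (nbrs r V A)
    have h2 := card_le_card hA
    have h3 : W.filter (fun w => ∃ v ∈ S₀ \ nbrs r V A, r v w) ⊆
        W.filter (fun w => ∃ v ∈ S₀, r v w) \ A := by
      intro w hw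
      simp only [mem_filter, mem_sdiff] at hw ⊢
      obtain ⟨hwW, v, ⟨hv, hvA⟩, hvw⟩ := hw
      exact ⟨⟨hwW, v, hv, hvw⟩, fun hwA => hvA (mem_nbrs.2 ⟨hSV (hS₀S hv), w, hwA, hvw⟩)⟩
    have h4 := card_le_card h3
    rw [card_sdiff_of_subset hA] at h4
    have h5 : (S₀ ∩ nbrs r V A).Nonempty := by
      obtain ⟨w, hw⟩ : A.Nonempty := card_pos.1 (by lia)
      obtain ⟨_, v, hv, hvw⟩ := mem_filter.1 (hA hw)
      exact ⟨v, mem_inter.2 ⟨hv, mem_nbrs.2 ⟨hSV (hS₀S hv), w, hw, hvw⟩⟩⟩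
    have h6 := hmin (S₀ \ nbrs r V A) ⟨sdiff_subset.trans hS₀S, card_pos.1 (by lia), by lia⟩
    have := card_pos.2 h5
    lia
  have hinj : Set.InjOn (fun q : Finset α × Finset α => q.1 ∪ q.2)
      ((S \ S₀).powerset ×ˢ S₀.powerset : Finset _) := by
    rintro ⟨A, B⟩ h ⟨A', B'⟩ h' he
    simp only [coe_product, coe_powerset, Set.mem_prod, Set.mem_preimage, Set.mem_powerset_iff,
      coe_subset] at h h' he
    have hd : ∀ x ∈ A, x ∉ S₀ := fun x hx => (mem_sdiff.1 (h.1 hx)).2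
    have hd' : ∀ x ∈ A', x ∉ S₀ := fun x hx => (mem_sdiff.1 (h'.1 hx)).2
    have hB := h.2
    have hB' := h'.2
    rw [Prod.mk.injEq]
    constructor <;> ext x <;> have := Finset.ext_iff.1 he x <;>
      simp only [mem_union] at this <;> have := hd x <;> have := hd' x <;>
      have := @hB x <;> have := @hB' x <;> tauto
  have himage : S.powerset =
      ((S \ S₀).powerset ×ˢ S₀.powerset).image fun q => q.1 ∪ q.2 := by
    ext T
    simp only [mem_powerset, mem_image, mem_product, Prod.exists]
    constructor
    · intro hT
      exact ⟨T \ S₀, T ∩ S₀, ⟨sdiff_subset_sdiff hT subset_rfl, inter_subset_right⟩,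
        sdiff_union_inter T S₀⟩
    · rintro ⟨A, B, ⟨hA, hB⟩, rfl⟩
      exact union_subset (hA.trans sdiff_subset) (hB.trans hS₀S)
  rw [himage, sum_image hinj, sum_product]
  refine sum_eq_zero fun A hA => ?_
  have h := alternating_card_demands_eq_zero_of_hall (hS₀S.trans hSV) hN₀ hall
    fun v => c v + if v ∈ A then 1 else 0
  rw [← mul_zero ((-1 : ℤ) ^ #A), ← h, mul_sum]
  refine sum_congr rfl fun B hB => ?_
  have hd : Disjoint A B := disjoint_of_subset_left (mem_powerset.1 hA)
    (disjoint_of_subset_right (mem_powerset.1 hB) sdiff_disjoint)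
  have he : (fun v => c v + if v ∈ A ∪ B then 1 else 0)
      = fun v => (c v + if v ∈ A then 1 else 0) + if v ∈ B then 1 else 0 := by
    ext v
    by_cases h1 : v ∈ A
    · simp [h1, disjoint_left.1 hd h1]
    · simp [h1]
  simp only [he, card_union_of_disjoint hd, pow_add, mul_assoc]

end Demands

/-! ### Lattice points of the root polytope -/

/-- Linear inequalities that hold at the vectors `e_v + e_w` hold on dilates of the root
polytope. -/
theorem le_sum_mul_of_mem_smul_rootPolytope {U : Type*} [Fintype U] [DecidableEq U]
    {G : SimpleGraph U} {s k : ℝ} (hs : 0 ≤ s) {l : U → ℝ}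
    (hl : ∀ v w, G.Adj v w → k ≤ l v + l w) {x : U → ℝ} (hx : x ∈ s • rootPolytope G) :
    s * k ≤ ∑ u, l u * x u := by
  obtain ⟨y, hy, rfl⟩ := Set.mem_smul_set.1 hx
  have hsub : rootPolytope G ⊆ {y | k ≤ (∑ u, l u • LinearMap.proj u : (U → ℝ) →ₗ[ℝ] ℝ) y} := by
    refine convexHull_min ?_ (convex_halfSpace_ge (LinearMap.isLinear _) k)
    rintro _ ⟨v, w, hvw, rfl⟩
    simpa [mul_add, sum_add_distrib, Pi.single_apply] using hl v w hvw
  have h := hsub hy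
  simp only [Set.mem_ofPred_eq, LinearMap.coe_sum, Finset.sum_apply, LinearMap.smul_apply,
    LinearMap.proj_apply, smul_eq_mul] at h
  calc s * k ≤ s * ∑ u, l u * y u := mul_le_mul_of_nonneg_left h hs
    _ = ∑ u, l u * (s • y) u := by
      rw [mul_sum]; exact sum_congr rfl fun u _ => by simp; ring

/-- By Hall's theorem, a supply vector and a demand vector that fit together can be matched unit
by unit along edges, which writes their sum as a sum of edge vectors. -/
theorem exists_matching_of_mem_demands {α β : Type*} [Fintype α] [Fintype β] [DecidableEq α]
    [DecidableEq β] {r : α → β → Prop} {V : Finset α} {W : Finset β} {a : α → ℕ} {b : β → ℕ}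
    (ha : ∀ v, a v ≠ 0 → v ∈ V) (hb : b ∈ demands r V W a) :
    ∃ f : ((w : β) × Fin (b w)) ≃ ((v : α) × Fin (a v)), ∀ i, r (f i).1 i.1 := by
  classical
  obtain ⟨hb1, hb2⟩ := mem_demands.1 hb
  rw [mem_piAntidiag] at hb1
  have hcardle : ∀ s : Finset ((w : β) × Fin (b w)),
      #s ≤ #(s.biUnion fun i => univ.filter fun k : (v : α) × Fin (a v) => r k.1 i.1) := by
    intro s
    have hX : s.image Sigma.fst ⊆ W := by
      intro w hw
      obtain ⟨i, _, rfl⟩ := mem_image.1 hw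
      exact hb1.2 _ (Nat.pos_iff_ne_zero.1 i.2.pos)
    calc #s ≤ #((s.image Sigma.fst).sigma fun w => (univ : Finset (Fin (b w)))) :=
          card_le_card fun i hi => mem_sigma.2 ⟨mem_image_of_mem _ hi, mem_univ _⟩
      _ = ∑ w ∈ s.image Sigma.fst, b w := by simp
      _ ≤ ∑ v ∈ nbrs r V (s.image Sigma.fst), a v := hb2 _ hX
      _ = #((nbrs r V (s.image Sigma.fst)).sigma fun v => (univ : Finset (Fin (a v)))) := by simp
      _ ≤ _ := card_le_card fun k hk => by
        obtain ⟨_, w, hw, hvw⟩ := mem_nbrs.1 (mem_sigma.1 hk).1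
        obtain ⟨i, hi, rfl⟩ := mem_image.1 hw
        exact mem_biUnion.2 ⟨i, hi, mem_filter.2 ⟨mem_univ _, hvw⟩⟩
  obtain ⟨f, hf, hfr⟩ := (all_card_le_biUnion_card_iff_exists_injective _).1 hcardle
  have hcard : Fintype.card ((w : β) × Fin (b w)) = Fintype.card ((v : α) × Fin (a v)) := by
    simp only [Fintype.card_sigma, Fintype.card_fin]
    rw [← sum_subset (subset_univ V) fun v _ hv => by_contra fun h => hv (ha v h), ← hb1.1]
    exact (sum_subset (subset_univ W) fun w _ hw => by_contra fun h => hw (hb1.2 w h)).symm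
  refine ⟨Equiv.ofBijective f ((Fintype.bijective_iff_injective_and_card f).2 ⟨hf, hcard⟩),
    fun i => ?_⟩
  simpa using hfr i

section Bipartite

variable {U : Type*} [Fintype U] [DecidableEq U] {G : SimpleGraph U} {V W J : Finset U}

theorem add_mem_smul_rootPolytope_deleteVertices (hJW : Disjoint J W) {s : ℕ} (hs : s ≠ 0)
    {a b : U → ℕ} (ha : a ∈ piAntidiag (V \ J) s) (hb : b ∈ demands G.Adj V W a) :
    (fun u : {u // u ∉ J} => (((a u + b u : ℕ) : ℤ) : ℝ)) ∈
      (s : ℝ) • rootPolytope (deleteVertices G J) := by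
  rw [mem_piAntidiag] at ha
  obtain ⟨f, hf⟩ := exists_matching_of_mem_demands
    (fun v hv => (mem_sdiff.1 (ha.2 v hv)).1) hb
  have hb1 := mem_piAntidiag.1 (mem_demands.1 hb).1
  have hVJ : ∀ i, (f i).1 ∉ J := fun i =>
    (mem_sdiff.1 (ha.2 _ (Nat.pos_iff_ne_zero.1 (f i).2.pos))).2
  have hWJ : ∀ i : (w : U) × Fin (b w), i.1 ∉ J := fun i =>
    disjoint_right.1 hJW (hb1.2 _ (Nat.pos_iff_ne_zero.1 i.2.pos))
  set e : ((w : U) × Fin (b w)) → {u // u ∉ J} → ℝ := fun i =>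
    Pi.single ⟨(f i).1, hVJ i⟩ 1 + Pi.single ⟨i.1, hWJ i⟩ 1 with he
  have hcard : (#(univ : Finset ((w : U) × Fin (b w))) : ℝ) = s := by
    rw [card_univ, Fintype.card_congr f]
    simp only [Fintype.card_sigma, Fintype.card_fin]
    rw [← sum_subset (subset_univ (V \ J)) fun v _ hv => by_contra fun h => hv (ha.2 v h), ha.1]
  have hs' : (s : ℝ) ≠ 0 := by exact_mod_cast hs
  refine Set.mem_smul_set.2 ⟨∑ i, (s : ℝ)⁻¹ • e i, ?_, ?_⟩
  · refine (convex_convexHull ℝ _).sum_mem (fun _ _ => by positivity) ?_ fun i _ => ?_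
    · rw [sum_const, nsmul_eq_mul, hcard, mul_inv_cancel₀ hs']
    · exact subset_convexHull ℝ _ ⟨⟨(f i).1, hVJ i⟩, ⟨i.1, hWJ i⟩, hf i, rfl⟩
  · rw [← smul_sum, smul_inv_smul₀ hs']
    ext u
    have h1 : ∑ i : (w : U) × Fin (b w), (Pi.single ⟨i.1, hWJ i⟩ 1 : {u // u ∉ J} → ℝ) u
        = b u := by
      simp only [Pi.single_apply, Subtype.ext_iff]
      rw [Fintype.sum_sigma,
        Fintype.sum_eq_single u.1 fun x hx => sum_eq_zero fun _ _ => if_neg hx.symm]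
      simp
    have h2 : ∑ i : (w : U) × Fin (b w), (Pi.single ⟨(f i).1, hVJ i⟩ 1 : {u // u ∉ J} → ℝ) u
        = a u := by
      simp only [Pi.single_apply, Subtype.ext_iff]
      rw [f.sum_comp fun k => if u.1 = k.1 then (1 : ℝ) else 0, Fintype.sum_sigma,
        Fintype.sum_eq_single u.1 fun x hx => sum_eq_zero fun _ _ => if_neg hx.symm]
      simp
    simp only [he, Finset.sum_apply, Pi.add_apply, sum_add_distrib, h1, h2]
    push_cast
    ring

/-- A lattice point of a dilate of the root polytope of `G - J`, extended by zero, satisfies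
Hall's condition in `G`. -/
theorem conditions_of_mem_smul_rootPolytope (hVW : Disjoint V W)
    (hG : ∀ v w, G.Adj v w → v ∈ V ∧ w ∈ W ∨ v ∈ W ∧ w ∈ V) {s : ℕ} {z : U → ℤ}
    (hzJ : ∀ u ∈ J, z u = 0)
    (hz : (fun u : {u // u ∉ J} => (z u : ℝ)) ∈ (s : ℝ) • rootPolytope (deleteVertices G J)) :
    (∀ u, 0 ≤ z u) ∧ ∑ v ∈ V, z v = s ∧ ∑ w ∈ W, z w = s ∧
      ∀ X ⊆ W, ∑ w ∈ X, z w ≤ ∑ v ∈ nbrs G.Adj V X, z v := by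
  have key : ∀ (k : ℤ) (l : U → ℤ), (∀ v ∈ V, ∀ w ∈ W, G.Adj v w → k ≤ l v + l w) →
      s * k ≤ ∑ u, l u * z u := by
    intro k l hl
    have h := le_sum_mul_of_mem_smul_rootPolytope (G := deleteVertices G J) (k := (k : ℝ))
      (l := fun u => (l u : ℝ))
      s.cast_nonneg (fun v w hvw => by
        rcases hG v w hvw with h | h
        · exact_mod_cast hl v h.1 w h.2 hvw
        · have := hl w h.2 v h.1 hvw.symm
          rw [add_comm] at this
          exact_mod_cast this) hz
    have h2 : ∑ u : {u // u ∉ J}, (l u : ℝ) * (z u : ℝ) = ((∑ u, l u * z u : ℤ) : ℝ) := by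
      push_cast
      rw [← Fintype.sum_subtype_add_sum_subtype (fun u => u ∉ J), left_eq_add]
      exact sum_eq_zero fun u _ => by simp [hzJ u.1 (not_not.1 u.2)]
    rw [h2] at h
    exact_mod_cast h
  have hind : ∀ A : Finset U, ∑ u, (if u ∈ A then 1 else 0) * z u = ∑ u ∈ A, z u := by
    intro A; simp
  have eqs : ∀ A : Finset U, (∀ v ∈ V, ∀ w ∈ W,
      (if v ∈ A then 1 else 0) + (if w ∈ A then 1 else 0) = (1 : ℤ)) → ∑ u ∈ A, z u = s := by
    intro A hA
    have h1 := key 1 (fun u => if u ∈ A then 1 else 0) fun v hv w hw _ => (hA v hv w hw).ge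
    have h2 := key (-1) (fun u => -(if u ∈ A then 1 else 0)) fun v hv w hw _ => by
      have := hA v hv w hw; lia
    simp only [neg_mul, sum_neg_distrib] at h2
    rw [hind] at h1 h2
    lia
  refine ⟨fun u => ?_, eqs V ?_, eqs W ?_, fun X hX => ?_⟩
  · have := key 0 (fun x => if x ∈ ({u} : Finset U) then 1 else 0) fun v _ w _ _ => by
      split_ifs <;> norm_num
    rw [hind] at this
    simpa using this
  · intro v hv w hw
    simp [hv, disjoint_right.1 hVW hw]
  · intro v hv w hw
    simp [hw, disjoint_left.1 hVW hv]
  · have := key 0 (fun u => (if u ∈ nbrs G.Adj V X then 1 else 0) - if u ∈ X then 1 else 0)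
      fun v hv w hw hvw => by
        have h1 : v ∉ X := fun h => disjoint_left.1 hVW hv (hX h)
        by_cases h2 : w ∈ X
        · have : v ∈ nbrs G.Adj V X := mem_nbrs.2 ⟨hv, w, h2, hvw⟩
          simp only [this, h1, h2, if_true, if_false]
          split_ifs <;> norm_num
        · simp only [h1, h2, if_false]
          split_ifs <;> norm_num
    simp only [sub_mul, sum_sub_distrib] at this
    rw [hind, hind] at this
    lia

/-- The lattice points of `s · Q_{G-J}` are the sums `a + b` of a supply vector `a` on `V \ J` with
sum `s` and a demand vector `b` fitting to `a`. -/
theorem latticeCount_deleteVertices (hVW : Disjoint V W) (hcov : V ∪ W = univ)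
    (hG : ∀ v w, G.Adj v w → v ∈ V ∧ w ∈ W ∨ v ∈ W ∧ w ∈ V) (hJV : J ⊆ V) {s : ℕ} (hs : s ≠ 0) :
    latticeCount (rootPolytope (deleteVertices G J)) s =
      ∑ a ∈ piAntidiag (V \ J) s, #(demands G.Adj V W a) := by
  have hJW : Disjoint J W := disjoint_of_subset_left hJV hVW
  rw [← card_sigma, ← Set.ncard_coe_finset, latticeCount]
  set φ : ((_ : U → ℕ) × (U → ℕ)) → {u // u ∉ J} → ℤ := fun q u => ((q.1 u + q.2 u : ℕ) : ℤ)
    with hφ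
  have hinj : Set.InjOn φ ((piAntidiag (V \ J) s).sigma fun a => demands G.Adj V W a) := by
    rintro ⟨a, b⟩ h ⟨a', b'⟩ h' he
    simp only [coe_sigma, Set.mem_sigma_iff, mem_coe, mem_demands, mem_piAntidiag] at h h'
    obtain ⟨⟨_, h1⟩, ⟨_, h2⟩, _⟩ := h
    obtain ⟨⟨_, h1'⟩, ⟨_, h2'⟩, _⟩ := h'
    have key : ∀ u, a u = a' u ∧ b u = b' u := by
      intro u
      have e1 := h1 u
      have e2 := h2 u
      have e1' := h1' u
      have e2' := h2' u
      have e3 := fun h : u ∈ V => disjoint_left.1 hVW h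
      rw [mem_sdiff] at e1 e1'
      by_cases huJ : u ∈ J
      · have := disjoint_left.1 hJW huJ
        grind
      · have := congrFun he ⟨u, huJ⟩
        simp only [hφ, Nat.cast_inj] at this
        grind
    have ea : a = a' := funext fun u => (key u).1
    have eb : b = b' := funext fun u => (key u).2
    subst ea eb; rfl
  rw [← hinj.ncard_image]
  congr 1
  ext z
  simp only [Set.mem_ofPred_eq, Set.mem_image, coe_sigma, Set.mem_sigma_iff, mem_coe, Sigma.exists]
  constructor
  · intro hz
    set y : U → ℤ := fun u => if h : u ∉ J then z ⟨u, h⟩ else 0 with hy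
    have hyz : ∀ u : {u // u ∉ J}, y u = z u := fun u => by simp [hy, u.2]
    have hyJ : ∀ u ∈ J, y u = 0 := fun u hu => by simp [hy, hu]
    simp only [← hyz] at hz
    obtain ⟨hy0, hyV, hyW, hyX⟩ := conditions_of_mem_smul_rootPolytope hVW hG hyJ hz
    lift y to U → ℕ using hy0 with n hn
    have hn' : ∀ u, y u = n u := fun u => by rw [← hn]
    simp only [← Nat.cast_sum, Nat.cast_inj, Nat.cast_le] at hyV hyW hyX hyJ hyz
    have hsumV : ∀ A ⊆ V, ∑ u ∈ A, (if u ∈ V then n u else 0) = ∑ u ∈ A, n u := fun A hA =>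
      sum_congr rfl fun u hu => if_pos (hA hu)
    have hsumW : ∀ A ⊆ W, ∑ u ∈ A, (if u ∈ W then n u else 0) = ∑ u ∈ A, n u := fun A hA =>
      sum_congr rfl fun u hu => if_pos (hA hu)
    refine ⟨fun u => if u ∈ V then n u else 0, fun u => if u ∈ W then n u else 0,
      ⟨mem_piAntidiag.2 ⟨?_, ?_⟩, mem_demands.2 ⟨mem_piAntidiag.2 ⟨?_, ?_⟩, ?_⟩⟩, ?_⟩
    · rw [hsumV _ sdiff_subset, ← hyV]
      refine sum_subset sdiff_subset fun u hu hu' => ?_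
      have : u ∈ J := by by_contra h; exact hu' (mem_sdiff.2 ⟨hu, h⟩)
      exact_mod_cast hyJ u this
    · intro u hu
      have hV : u ∈ V := by by_contra h; simp [h] at hu
      rw [if_pos hV] at hu
      exact mem_sdiff.2 ⟨hV, fun h => hu (by exact_mod_cast hyJ u h)⟩
    · rw [hsumV _ subset_rfl, hsumW _ subset_rfl, hyV, hyW]
    · intro u hu
      by_contra h; simp [h] at hu
    · intro X hX
      rw [hsumV _ (nbrs_subset _), hsumW _ hX]
      exact hyX X hX
    · ext u
      rw [← hyz]
      have e1 : u.1 ∈ V ∪ W := by simp [hcov]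
      have e2 := fun h : u.1 ∈ V => disjoint_left.1 hVW h
      simp only [hφ]
      by_cases h : u.1 ∈ V
      · simp [h, e2 h]
      · have : u.1 ∈ W := by simpa [h] using e1
        simp [h, this]
  · rintro ⟨a, b, ⟨ha, hb⟩, rfl⟩
    exact add_mem_smul_rootPolytope_deleteVertices hJW hs ha hb

end Bipartite

/-! ### Generating functions -/

section Series

variable {U : Type*} [Fintype U] [DecidableEq U] {G : SimpleGraph U} {V W J S T : Finset U}

theorem coeff_ehrhartSeries_deleteVertices (hVW : Disjoint V W) (hcov : V ∪ W = univ)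
    (hG : ∀ v w, G.Adj v w → v ∈ V ∧ w ∈ W ∨ v ∈ W ∧ w ∈ V) (hJV : J ⊆ V) (m : ℕ) :
    PowerSeries.coeff m (ehrhartSeries (rootPolytope (deleteVertices G J))) =
      ∑ a ∈ piAntidiag (V \ J) m, (#(demands G.Adj V W a) : ℤ) := by
  rw [ehrhartSeries, PowerSeries.coeff_mk]
  split_ifs with hm
  · subst hm
    have : demands G.Adj V W 0 = {0} := by
      ext b
      rw [mem_demands]
      simp only [Pi.zero_apply, sum_const_zero, piAntidiag_zero, mem_singleton,
        and_iff_left_iff_imp]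
      rintro rfl
      simp
    simp [this]
  · rw [latticeCount_deleteVertices hVW hcov hG hJV hm, Nat.cast_sum]

variable (G V W) in
/-- The generating function `∑ x ^ |a|` over all pairs of a supply vector `a ∈ ℕ^V` that is
positive on `T` and a demand vector fitting to `a`. -/
noncomputable def positiveSeries (T : Finset U) : PowerSeries ℤ :=
  PowerSeries.mk fun m =>
    ∑ a ∈ (piAntidiag V m).filter fun a => ∀ v ∈ T, a v ≠ 0, (#(demands G.Adj V W a) : ℤ)

/-- Deleting `J` forces the supplies on `J` to vanish; inclusion-exclusion replaces this by
positivity conditions. -/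
theorem ehrhartSeries_deleteVertices (hVW : Disjoint V W) (hcov : V ∪ W = univ)
    (hG : ∀ v w, G.Adj v w → v ∈ V ∧ w ∈ W ∨ v ∈ W ∧ w ∈ V) (hJV : J ⊆ V) :
    ehrhartSeries (rootPolytope (deleteVertices G J)) =
      ∑ T ∈ J.powerset, (-1) ^ #T * positiveSeries G V W T := by
  ext m
  have hsign : ∀ k : ℕ, ((-1) ^ k : PowerSeries ℤ) = PowerSeries.C ((-1) ^ k) := by simp
  rw [coeff_ehrhartSeries_deleteVertices hVW hcov hG hJV, map_sum]
  simp only [hsign, PowerSeries.coeff_C_mul, positiveSeries, PowerSeries.coeff_mk, sum_filter,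
    mul_sum]
  rw [sum_comm]
  have hinner : ∀ a : U → ℕ, ∑ T ∈ J.powerset, (-1 : ℤ) ^ #T *
      (if ∀ v ∈ T, a v ≠ 0 then (#(demands G.Adj V W a) : ℤ) else 0) =
      if ∀ v ∈ J, a v = 0 then (#(demands G.Adj V W a) : ℤ) else 0 := by
    intro a
    have h1 : J.powerset.filter (fun T => ∀ v ∈ T, a v ≠ 0)
        = (J.filter fun v => a v ≠ 0).powerset := by
      ext T
      simp only [mem_filter, mem_powerset, subset_iff]
      exact ⟨fun h v hv => ⟨h.1 hv, h.2 v hv⟩, fun h => ⟨fun v hv => (h hv).1, fun v hv => (h hv).2⟩⟩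
    simp only [mul_ite, mul_zero]
    rw [← sum_filter, h1, ← sum_mul, sum_powerset_neg_one_pow_card]
    simp [filter_eq_empty_iff]
  rw [sum_congr rfl fun a _ => hinner a, ← sum_filter]
  refine sum_congr ?_ fun _ _ => rfl
  ext a
  simp only [mem_piAntidiag, mem_filter, mem_sdiff]
  constructor
  · rintro ⟨h1, h2⟩
    refine ⟨⟨?_, fun i hi => (h2 i hi).1⟩, fun v hv => by_contra fun h => (h2 v h).2 hv⟩
    rw [← h1]
    exact (sum_subset sdiff_subset fun v _ hv =>
      by_contra fun h => hv (mem_sdiff.2 (h2 v h))).symm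
  · rintro ⟨⟨h1, h2⟩, h3⟩
    refine ⟨?_, fun i hi => ⟨h2 i hi, fun h => hi (h3 i h)⟩⟩
    rw [← h1]
    exact sum_subset sdiff_subset fun v hv hv' =>
      h3 v (by_contra fun h => hv' (mem_sdiff.2 ⟨hv, h⟩))

/-- Subtracting the indicator vector of `T` from a supply vector that is positive on `T` leaves an
arbitrary supply vector. -/
theorem positiveSeries_eq (hTV : T ⊆ V) :
    positiveSeries G V W T = PowerSeries.X ^ #T * PowerSeries.mk fun m =>
      ∑ c ∈ piAntidiag V m,
        (#(demands G.Adj V W fun v => c v + if v ∈ T then 1 else 0) : ℤ) := by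
  ext m
  rw [positiveSeries, PowerSeries.coeff_mk, PowerSeries.coeff_X_pow_mul']
  split_ifs with hm
  · rw [PowerSeries.coeff_mk]
    refine sum_nbij' (fun a v => a v - if v ∈ T then 1 else 0)
      (fun c v => c v + if v ∈ T then 1 else 0) ?_ ?_ ?_ ?_ ?_
    · intro a ha
      simp only [mem_filter, mem_piAntidiag] at ha ⊢
      obtain ⟨⟨h1, h2⟩, h3⟩ := ha
      refine ⟨?_, fun i hi => h2 i (by lia)⟩
      have h4 := sum_add_indicator (c := fun v => a v - if v ∈ T then 1 else 0) (T := T) (Z := V)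
      rw [inter_eq_left.2 hTV] at h4
      have h5 : ∑ v ∈ V, ((a v - if v ∈ T then 1 else 0) + if v ∈ T then 1 else 0)
          = ∑ v ∈ V, a v := by
        refine sum_congr rfl fun v _ => ?_
        have := h3 v
        split_ifs with h
        · have := this h; lia
        · lia
      rw [h5] at h4
      change ∑ v ∈ V, a v = m at h1
      change ∑ v ∈ V, (a v - if v ∈ T then 1 else 0) = _
      lia
    · intro c hc
      simp only [mem_filter, mem_piAntidiag] at hc ⊢
      obtain ⟨h1, h2⟩ := hc
      refine ⟨⟨?_, fun i hi => ?_⟩, fun v hv => by simp [hv]⟩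
      · rw [sum_add_indicator, inter_eq_left.2 hTV]
        change ∑ v ∈ V, c v = _ at h1
        lia
      · by_cases h : i ∈ T
        · exact hTV h
        · exact h2 i (by simpa [h] using hi)
    · intro a ha
      simp only [mem_filter] at ha
      funext v
      have := ha.2 v
      split_ifs with h
      · have := this h; lia
      · lia
    · intro c _
      funext v
      simp
    · intro a ha
      simp only [mem_filter] at ha
      congr 3
      funext v
      have := ha.2 v
      split_ifs with h
      · have := this h; lia
      · lia
  · refine sum_eq_zero fun a ha => absurd ?_ hm
    simp only [mem_filter, mem_piAntidiag] at ha
    calc #T = ∑ v ∈ T, 1 := by simp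
      _ ≤ ∑ v ∈ T, a v := sum_le_sum fun v hv => Nat.one_le_iff_ne_zero.2 (ha.2 v hv)
      _ ≤ ∑ v ∈ V, a v := sum_le_sum_of_subset hTV
      _ = m := ha.1.1

/-- A binomial inversion: summing over the sets `J` between `T` and `S` turns powers of `y` into
powers of `y - 1`. -/
theorem sum_powerset_neg_one_pow_mul_pow_mul_sum {ι R : Type*} [DecidableEq ι] [CommRing R]
    (y : R) (S : Finset ι) (E : Finset ι → R) :
    ∑ J ∈ S.powerset, (-1) ^ #J * (y ^ (#S - #J) * ∑ T ∈ J.powerset, (-1) ^ #T * E T) =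
      ∑ T ∈ S.powerset, (y - 1) ^ (#S - #T) * E T := by
  induction S using Finset.induction_on generalizing E with
  | empty => simp
  | insert v S hv ih =>
    rw [sum_powerset_insert hv, sum_powerset_insert hv, ← sum_add_distrib]
    have h1 : ∀ T ∈ S.powerset, (y - 1) ^ (#(insert v S) - #T) * E T
        = (y - 1) * ((y - 1) ^ (#S - #T) * E T) := by
      intro T hT
      have := card_le_card (mem_powerset.1 hT)
      rw [card_insert_of_notMem hv, Nat.succ_sub this, pow_succ]
      ring
    have h2 : ∀ T ∈ S.powerset, (y - 1) ^ (#(insert v S) - #(insert v T)) * E (insert v T)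
        = (y - 1) ^ (#S - #T) * E (insert v T) := by
      intro T hT
      rw [card_insert_of_notMem hv, card_insert_of_notMem fun h => hv (mem_powerset.1 hT h),
        Nat.add_sub_add_right]
    rw [sum_congr rfl h1, sum_congr rfl h2, ← mul_sum, ← ih, ← ih fun T => E (insert v T),
      mul_sum, ← sum_add_distrib]
    refine sum_congr rfl fun J hJ => ?_
    have hJS := mem_powerset.1 hJ
    have hvJ : v ∉ J := fun h => hv (hJS h)
    have h3 : ∑ T ∈ J.powerset, (-1) ^ #(insert v T) * E (insert v T)
        = - ∑ T ∈ J.powerset, (-1) ^ #T * E (insert v T) := by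
      rw [← sum_neg_distrib]
      refine sum_congr rfl fun T hT => ?_
      rw [card_insert_of_notMem fun h => hvJ (mem_powerset.1 hT h), pow_succ]
      ring
    rw [sum_powerset_insert hvJ, h3, card_insert_of_notMem hv, card_insert_of_notMem hvJ,
      Nat.add_sub_add_right, Nat.succ_sub (card_le_card hJS), pow_succ, pow_succ]
    ring

theorem alternating_sum_positiveSeries (hSV : S ⊆ V) (hS : S.Nonempty)
    (hdeg : ∀ v ∈ S, ∃ w ∈ W, G.Adj v w) [DecidablePred fun w => ∃ v ∈ S, G.Adj v w]
    (hne : #(W.filter fun w => ∃ v ∈ S, G.Adj v w) ≤ #S) :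
    ∑ T ∈ S.powerset, (-PowerSeries.X) ^ (#S - #T) * positiveSeries G V W T = 0 := by
  have hterm : ∀ T ∈ S.powerset, (-PowerSeries.X) ^ (#S - #T) * positiveSeries G V W T =
      PowerSeries.X ^ #S * (-1) ^ #S * (PowerSeries.C ((-1) ^ #T) * PowerSeries.mk fun m =>
        ∑ c ∈ piAntidiag V m,
          (#(demands G.Adj V W fun v => c v + if v ∈ T then 1 else 0) : ℤ)) := by
    intro T hT
    obtain ⟨k, hk⟩ := Nat.exists_eq_add_of_le (card_le_card (mem_powerset.1 hT))
    have h1 : ((-1 : PowerSeries ℤ)) ^ #T * (-1) ^ #T = 1 := by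
      rw [← mul_pow]; simp
    rw [positiveSeries_eq ((mem_powerset.1 hT).trans hSV), hk, Nat.add_sub_cancel_left,
      neg_pow, pow_add, pow_add, map_pow, map_neg, map_one]
    linear_combination (-(PowerSeries.X ^ #T * PowerSeries.X ^ k * (-1) ^ k *
      PowerSeries.mk fun m => ∑ c ∈ piAntidiag V m,
        (#(demands G.Adj V W fun v => c v + if v ∈ T then 1 else 0) : ℤ))) * h1
  rw [sum_congr rfl hterm, ← mul_sum]
  convert mul_zero _
  ext m
  simp only [map_sum, PowerSeries.coeff_C_mul, PowerSeries.coeff_mk, mul_sum, map_zero]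
  rw [sum_comm]
  refine sum_eq_zero fun c _ => alternating_card_demands_eq_zero hSV hS hdeg ?_ c
  convert hne

end Series

theorem theorem1p1 {U : Type*} [Fintype U] [DecidableEq U] (G : SimpleGraph U)
    (V W : Set U) (hVW : IsCompl V W) (hG : G.IsBipartiteWith V W)
    (S : Finset U) (hSV : (S : Set U) ⊆ V) (hS : S.Nonempty)
    (hN : ∀ v ∈ S, (G.neighborSet v).Nonempty) (hne : IsNonExpanding G S) :
    ∑ J ∈ S.powerset, (-1 : PowerSeries ℤ) ^ J.card * interiorPolynomial (deleteVertices G J) = 0 := by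
  classical
  lift V to Finset U using V.toFinite
  lift W to Finset U using W.toFinite
  rw [coe_subset] at hSV
  have hdisj : Disjoint V W := disjoint_coe.1 hVW.disjoint
  have hcov : V ∪ W = univ := by
    have := hVW.sup_eq_top
    apply coe_injective
    simpa using this
  have hAdj : ∀ v w, G.Adj v w → v ∈ V ∧ w ∈ W ∨ v ∈ W ∧ w ∈ V := fun v w h => by
    simpa using hG.mem_of_adj h
  have hAdjW : ∀ v ∈ S, ∀ w, G.Adj v w → w ∈ W := fun v hv w hvw =>
    (hAdj v w hvw).elim And.right fun h => absurd h.1 (disjoint_left.1 hdisj (hSV hv))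
  have hdeg : ∀ v ∈ S, ∃ w ∈ W, G.Adj v w := fun v hv =>
    (hN v hv).imp fun w hw => ⟨hAdjW v hv w hw, hw⟩
  have hne' : #(W.filter fun w => ∃ v ∈ S, G.Adj v w) ≤ #S := by
    refine le_trans ?_ hne
    rw [← Set.ncard_coe_finset]
    refine Set.ncard_le_ncard ?_ (Set.toFinite _)
    intro w hw
    simpa [neighborsOf] using (mem_filter.1 hw).2
  have hlt : #S < Fintype.card U := by
    obtain ⟨v, hv⟩ := hS
    obtain ⟨w, hw, _⟩ := hdeg v hv
    exact card_lt_univ_of_notMem (x := w) fun h => disjoint_left.1 hdisj (hSV h) hw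
  have hterm : ∀ J ∈ S.powerset,
      (-1 : PowerSeries ℤ) ^ #J * interiorPolynomial (deleteVertices G J) =
      (1 - PowerSeries.X) ^ (Fintype.card U - 1 - #S) * ((-1) ^ #J *
        ((1 - PowerSeries.X) ^ (#S - #J) *
          ∑ T ∈ J.powerset, (-1) ^ #T * positiveSeries G V W T)) := by
    intro J hJ
    have hJS := mem_powerset.1 hJ
    have hJc := card_le_card hJS
    have hcard : Nat.card {u // u ∉ J} = Fintype.card U - #J := by
      rw [Nat.card_eq_fintype_card, Fintype.card_subtype_compl]; simp
    have hexp : Fintype.card U - #J - 1 = (Fintype.card U - 1 - #S) + (#S - #J) := by lia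
    rw [interiorPolynomial, hcard, hexp,
      ehrhartSeries_deleteVertices hdisj hcov hAdj (hJS.trans hSV), pow_add]
    ring
  rw [sum_congr rfl hterm, ← mul_sum, sum_powerset_neg_one_pow_mul_pow_mul_sum,
    show (1 - PowerSeries.X - 1 : PowerSeries ℤ) = -PowerSeries.X by ring,
    alternating_sum_positiveSeries hSV hS hdeg hne', mul_zero]
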